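/- Let $\mathbb H=\{z=x+iy\in\mathbb C: y>0\}$ and let $k$ be an integer. For a smooth function $f:\mathbb H\to\mathbb C$ (i.e. $C^\infty$ in the real variables $x,y$) put $$\frac{\partial f}{\partial\bar z}=\frac12\left(\frac{\partial f}{\partial x}+i\frac{\partial f}{\partial y}\right),\qquad \xi_k f=2i\,y^k\,\overline{\frac{\partial f}{\partial\bar z}},$$ $$\Delta_k f=y^2\left(\frac{\partial^2 f}{\partial x^2}+\frac{\partial^2 f}{\partial y^2}\right)-iky\left(\frac{\partial f}{\partial x}+i\frac{\partial f}{\partial y}\right).$$ A smooth (not necessarily holomorphic) modular form of weight $k$ for $\mathrm{SL}_2(\mathbb Z)$ is a smooth function $f:\mathbb H\to\mathbb C$ such that $f\left(\frac{az+b}{cz+d}\right)=(cz+d)^kf(z)$ for all $z\in\mathbb H$ and all $\begin{pmatrix}a&b\\c&d\end{pmatrix}\in\mathrm{SL}_2(\mathbb Z)$; it has polynomial (moderate) growth if there is $\alpha\in\mathbb R$ with $f(x+iy)=O(y^\alpha)$ as $y\to\infty$, uniformly in $x\in\mathbb R$. Let $V_k^1(0)$ be the space of smooth modular forms $f$ of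 weight $k$ for $\mathrm{SL}_2(\mathbb Z)$ that have polynomial growth and satisfy $\Delta_kf=0$. **Proposition.** Let $g$ be a nonzero holomorphic cusp form of weight $k$ for $\mathrm{SL}_2(\mathbb Z)$. 1. If $M$ is a smooth modular form of weight $k$ for $\mathrm{SL}_2(\mathbb Z)$ with $\Delta_kM=g$, then $M$ does not have polynomial growth. 2. There is no $f\in V_{2-k}^1(0)$ with $\xi_{2-k}f=g$. -/

import Mathlib

open UpperHalfPlane
open scoped MatrixGroups ModularForm ContDiff

noncomputable section

namespace PolyMaass

/-- `f` is `C^∞` as a function of the two real variables `x, y`, where `z = x + iy`. -/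
def IsSmooth (f : ℍ → ℂ) : Prop :=
  ContDiffOn ℝ ∞ (f ∘ ofComplex) {z : ℂ | 0 < z.im}

/-- The partial derivative `∂f/∂x`. -/
def partialX (f : ℍ → ℂ) (z : ℍ) : ℂ :=
  fderiv ℝ (f ∘ ofComplex) (z : ℂ) 1

/-- The partial derivative `∂f/∂y`. -/
def partialY (f : ℍ → ℂ) (z : ℍ) : ℂ :=
  fderiv ℝ (f ∘ ofComplex) (z : ℂ) Complex.I

/-- The Wirtinger derivative `∂f/∂z̄ = (1/2) (∂f/∂x + i ∂f/∂y)`. -/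
def dbar (f : ℍ → ℂ) (z : ℍ) : ℂ :=
  (1 / 2 : ℂ) * (partialX f z + Complex.I * partialY f z)

/-- The operator `ξ_k f = 2 i y^k conj (∂f/∂z̄)`. -/
def xi (k : ℤ) (f : ℍ → ℂ) (z : ℍ) : ℂ :=
  2 * Complex.I * (z.im : ℂ) ^ k * (starRingEnd ℂ) (dbar f z)

/-- The weight `k` hyperbolic Laplacian
`Δ_k = y² (∂²/∂x² + ∂²/∂y²) - i k y (∂/∂x + i ∂/∂y)`. -/
def hypLaplacian (k : ℤ) (f : ℍ → ℂ) (z : ℍ) : ℂ :=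
  (z.im : ℂ) ^ 2 * (partialX (partialX f) z + partialY (partialY f) z)
    - Complex.I * (k : ℂ) * (z.im : ℂ) * (partialX f z + Complex.I * partialY f z)

/-- Smooth, not necessarily holomorphic, weight `k` modular forms for `SL(2, ℤ)`,
with no growth condition at the cusp. -/
structure IsSmoothModularForm (k : ℤ) (f : ℍ → ℂ) : Prop where
  smooth : IsSmooth f
  slash_eq : ∀ γ : SL(2, ℤ), f ∣[k] γ = f

/-- Moderate (polynomial) growth: for some real `α`, `f (x + iy) = O(y ^ α)` as `y → ∞`,
uniformly in `x`. -/
def HasModerateGrowth (f : ℍ → ℂ) : Prop :=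
  ∃ α : ℝ, f =O[atImInfty] fun z : ℍ => z.im ^ α

/-- The space `V_k^m(0)` of weight `k` polyharmonic Maass forms for `SL(2, ℤ)`, for integer `m`:
smooth modular forms of weight `k` and moderate growth with `(Δ_k)^m f = 0`. -/
def polyharmonicMaassForms (k : ℤ) (m : ℕ) : Set (ℍ → ℂ) :=
  {f | IsSmoothModularForm k f ∧ (hypLaplacian k)^[m] f = 0 ∧ HasModerateGrowth f}

end PolyMaass

end

/-!
If `ξ_{2-k} F = g`, then `ω = F g dz` is an invariant form of weight two and
`dω = -|g|² y^(k-2) dx ∧ dy` is, up to sign, the density of the Petersson norm. By Stokes' theorem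
on the standard fundamental domain truncated at height `y`, where the arc contributes nothing
because `S` reverses it, the constant term of `F g` at height `y` has real part at least some
`δ > 0` for all `y ≥ 2`. This is impossible if `F` grows more slowly than `g` decays, that is, more
slowly than `e^(2πy)`.

If `Δ_k M = g`, the same bound applies to `F = ξ_k M`, because `Δ_k = ξ_{2-k} ξ_k`, but no growth
of the derivatives of `M` is known. Instead, the constant term of `ξ_k M · g` is, up to a
remainder without derivatives of `M`, the `y`-derivative of the constant term of `M y^k conj g`.
The bound forces the latter to grow linearly, whereas slow growth of `M` makes it tend to zero.
-/

namespace PolyMaass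

open Complex MeasureTheory Set Filter Topology Asymptotics
open scoped Interval ComplexConjugate

section RealParameter

variable {E : Type*} [NormedAddCommGroup E] [NormedSpace ℝ E]

theorem hasDerivAt_intervalIntegral_of_continuousOn {F F' : ℝ → ℝ → E} {a b t₀ : ℝ}
    {s : Set ℝ} (hs : s ∈ 𝓝 t₀) (hF : ∀ t ∈ s, ContinuousOn (F t) [[a, b]])
    (hF' : ContinuousOn (Function.uncurry F') (s ×ˢ [[a, b]]))
    (hd : ∀ t ∈ s, ∀ x ∈ [[a, b]], HasDerivAt (F · x) (F' t x) t) :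
    HasDerivAt (fun t ↦ ∫ x in a..b, F t x) (∫ x in a..b, F' t₀ x) t₀ := by
  obtain ⟨r, hr, hball⟩ := Metric.nhds_basis_closedBall.mem_iff.1 hs
  have hball_nhds : Metric.closedBall t₀ r ∈ 𝓝 t₀ := Metric.closedBall_mem_nhds t₀ hr
  obtain ⟨C, hC⟩ := ((isCompact_closedBall t₀ r).prod isCompact_uIcc).exists_bound_of_continuousOn
    (hF'.mono (prod_mono_left hball))
  have hF'₀ : ContinuousOn (F' t₀) [[a, b]] :=
    hF'.uncurry_left t₀ (mem_of_mem_nhds hs)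
  refine (intervalIntegral.hasDerivAt_integral_of_dominated_loc_of_deriv_le (bound := fun _ ↦ C)
    hball_nhds ?_ (hF t₀ (mem_of_mem_nhds hs)).intervalIntegrable
    (hF'₀.mono uIoc_subset_uIcc |>.aestronglyMeasurable measurableSet_uIoc)
    (.of_forall fun x hx t ht ↦ hC (t, x) ⟨ht, uIoc_subset_uIcc hx⟩) intervalIntegrable_const
    (.of_forall fun x hx t ht ↦ hd t (hball ht) x (uIoc_subset_uIcc hx))).2
  filter_upwards [hs] with t ht
  exact ((hF t ht).mono uIoc_subset_uIcc).aestronglyMeasurable measurableSet_uIoc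

theorem tendsto_atTop_of_eventually_le_deriv {A A' : ℝ → ℝ} {δ : ℝ} (hδ : 0 < δ)
    (hA : ∀ᶠ y in atTop, HasDerivAt A (A' y) y) (hle : ∀ᶠ y in atTop, δ ≤ A' y) :
    Tendsto A atTop atTop := by
  obtain ⟨N, hN⟩ := eventually_atTop.1 (hA.and hle)
  have hlinear : Tendsto (fun y ↦ A N + δ * (y - N)) atTop atTop :=
    tendsto_atTop_add_const_left _ _
      ((tendsto_atTop_add_const_right _ (-N) tendsto_id).const_mul_atTop hδ)
  refine tendsto_atTop_mono' _ ?_ hlinear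
  filter_upwards [eventually_ge_atTop N] with y hy
  have := (convex_Ici N).mul_sub_le_image_sub_of_le_deriv
    (fun t ht ↦ (hN t ht).1.continuousAt.continuousWithinAt)
    (fun t ht ↦ (hN t (interior_subset ht)).1.differentiableAt.differentiableWithinAt)
    (fun t ht ↦ (hN t (interior_subset ht)).1.deriv ▸ (hN t (interior_subset ht)).2)
    N self_mem_Ici y hy hy
  linarith

end RealParameter

section CauchyRiemann

/-- The operator `∂/∂x + i ∂/∂y = 2 ∂/∂z̄` on functions of a complex variable. -/
noncomputable def cauchyRiemann (F : ℂ → ℂ) (z : ℂ) : ℂ :=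
  fderiv ℝ F z 1 + Complex.I * fderiv ℝ F z Complex.I

/-- The operator `∂/∂x - i ∂/∂y = 2 ∂/∂z` on functions of a complex variable. -/
noncomputable def conjCauchyRiemann (F : ℂ → ℂ) (z : ℂ) : ℂ :=
  fderiv ℝ F z 1 - Complex.I * fderiv ℝ F z Complex.I

theorem realLinear_apply (L : ℂ →L[ℝ] ℂ) (w : ℂ) : L w = w.re * L 1 + w.im * L Complex.I := by
  calc L w = L (w.re • (1 : ℂ) + w.im • Complex.I) := by simp
    _ = w.re * L 1 + w.im * L Complex.I := by rw [map_add, map_smul, map_smul]; simp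

theorem realLinear_apply_mul_sub (L : ℂ →L[ℝ] ℂ) (u v : ℂ) :
    L u * v - L v * u = Complex.I * (conj u * v).im * (L 1 + Complex.I * L Complex.I) := by
  rw [realLinear_apply L u, realLinear_apply L v, mul_im, conj_re, conj_im]
  push_cast
  linear_combination (v.re * L 1 + v.im * L Complex.I) * Complex.re_add_im u -
    (u.re * L 1 + u.im * L Complex.I) * Complex.re_add_im v -
    (u.re * v.im - u.im * v.re : ℂ) * L Complex.I * I_sq

theorem realLinear_apply_add_I_mul (L : ℂ →L[ℝ] ℂ) (w : ℂ) :
    L w + Complex.I * L (Complex.I * w) = conj w * (L 1 + Complex.I * L Complex.I) := by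
  have hw : conj w = w.re - w.im * Complex.I := by
    apply Complex.ext <;> simp
  rw [realLinear_apply L w, realLinear_apply L (Complex.I * w), hw, I_mul_re, I_mul_im]
  push_cast
  linear_combination (w.im : ℂ) * L Complex.I * I_sq

theorem fderiv_real_eq_mul_deriv {G : ℂ → ℂ} {z : ℂ} (hG : DifferentiableAt ℂ G z) (v : ℂ) :
    fderiv ℝ G z v = v * deriv G z := by
  rw [hG.fderiv_restrictScalars ℝ]
  simp

theorem fderiv_conj_comp {F : ℂ → ℂ} {z : ℂ} (hF : DifferentiableAt ℝ F z) (v : ℂ) :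
    fderiv ℝ (fun w ↦ conj (F w)) z v = conj (fderiv ℝ F z v) := by
  have : HasFDerivAt (fun w ↦ conj (F w)) _ z :=
    conjCLE.toContinuousLinearMap.hasFDerivAt.comp z hF.hasFDerivAt
  rw [this.fderiv]
  rfl

variable {F H : ℂ → ℂ} {z : ℂ}

theorem cauchyRiemann_congr (h : F =ᶠ[𝓝 z] H) : cauchyRiemann F z = cauchyRiemann H z := by
  simp only [cauchyRiemann, h.fderiv_eq]

theorem cauchyRiemann_mul (hF : DifferentiableAt ℝ F z) (hH : DifferentiableAt ℝ H z) :
    cauchyRiemann (fun w ↦ F w * H w) z = cauchyRiemann F z * H z + F z * cauchyRiemann H z := by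
  simp only [cauchyRiemann, fderiv_fun_mul hF hH, add_apply, smul_apply, smul_eq_mul]
  ring

theorem cauchyRiemann_conj (hF : DifferentiableAt ℝ F z) :
    cauchyRiemann (fun w ↦ conj (F w)) z = conj (conjCauchyRiemann F z) := by
  simp only [cauchyRiemann, conjCauchyRiemann, fderiv_conj_comp hF, map_sub, map_mul, conj_I]
  ring

theorem cauchyRiemann_eq_zero (hF : DifferentiableAt ℂ F z) : cauchyRiemann F z = 0 := by
  simp only [cauchyRiemann, fderiv_real_eq_mul_deriv hF]
  linear_combination deriv F z * I_sq

theorem conjCauchyRiemann_eq_two_mul_deriv (hF : DifferentiableAt ℂ F z) :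
    conjCauchyRiemann F z = 2 * deriv F z := by
  simp only [conjCauchyRiemann, fderiv_real_eq_mul_deriv hF]
  linear_combination -deriv F z * I_sq

theorem cauchyRiemann_mul_of_differentiableAt (hF : DifferentiableAt ℝ F z)
    (hH : DifferentiableAt ℂ H z) :
    cauchyRiemann (fun w ↦ F w * H w) z = cauchyRiemann F z * H z := by
  rw [cauchyRiemann_mul hF (hH.restrictScalars ℝ), cauchyRiemann_eq_zero hH, mul_zero, add_zero]

theorem cauchyRiemann_comp {σ : ℂ → ℂ} (hF : DifferentiableAt ℝ F (σ z))
    (hσ : DifferentiableAt ℂ σ z) :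
    cauchyRiemann (fun w ↦ F (σ w)) z = conj (deriv σ z) * cauchyRiemann F (σ z) := by
  have hchain (v : ℂ) : fderiv ℝ (fun w ↦ F (σ w)) z v = fderiv ℝ F (σ z) (v * deriv σ z) := by
    rw [fderiv_fun_comp z hF (hσ.restrictScalars ℝ), ContinuousLinearMap.comp_apply,
      fderiv_real_eq_mul_deriv hσ]
  simp only [cauchyRiemann, hchain, one_mul, realLinear_apply_add_I_mul]

theorem hasFDerivAt_im_zpow (k : ℤ) (hz : z.im ≠ 0) :
    HasFDerivAt (fun w : ℂ ↦ ((w.im ^ k : ℝ) : ℂ))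
      (ofRealCLM.comp (((k : ℝ) * z.im ^ (k - 1)) • imCLM)) z :=
  ofRealCLM.hasFDerivAt.comp z
    ((hasDerivAt_zpow k z.im (Or.inl hz)).comp_hasFDerivAt z imCLM.hasFDerivAt)

theorem cauchyRiemann_im_zpow (k : ℤ) (hz : z.im ≠ 0) :
    cauchyRiemann (fun w : ℂ ↦ ((w.im ^ k : ℝ) : ℂ)) z =
      Complex.I * (k * (z.im ^ (k - 1) : ℝ)) := by
  simp only [cauchyRiemann, (hasFDerivAt_im_zpow k hz).fderiv]
  simp

theorem contDiffAt_im_zpow (k : ℤ) {n : WithTop ℕ∞} (hz : z.im ≠ 0) :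
    ContDiffAt ℝ n (fun w : ℂ ↦ ((w.im ^ k : ℝ) : ℂ)) z := by
  have hpow : ContDiffAt ℝ n (fun y : ℝ ↦ y ^ k) z.im := by
    cases k with
    | ofNat m => simpa using contDiffAt_id.pow m
    | negSucc m =>
      simp only [zpow_negSucc]
      exact (contDiffAt_id.pow (m + 1)).inv (pow_ne_zero _ hz)
  exact ofRealCLM.contDiff.contDiffAt.comp z (hpow.comp z imCLM.contDiff.contDiffAt)

variable {U : Set ℂ}

theorem contDiffOn_cauchyRiemann {n m : WithTop ℕ∞} (hF : ContDiffOn ℝ n F U)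
    (hU : IsOpen U) (hmn : m + 1 ≤ n) : ContDiffOn ℝ m (cauchyRiemann F) U := by
  have h := hF.fderiv_of_isOpen hU hmn
  exact (h.clm_apply contDiffOn_const).add
    (contDiffOn_const.mul (h.clm_apply contDiffOn_const))

theorem integral_fderiv_mul_add_comp_mul (hF : ContDiffOn ℝ 1 F U) (hU : IsOpen U)
    {γ γ' q q' : ℝ → ℂ} {a b : ℝ} (hγ : ∀ x ∈ [[a, b]], HasDerivAt γ (γ' x) x)
    (hq : ∀ x ∈ [[a, b]], HasDerivAt q (q' x) x) (hγ' : ContinuousOn γ' [[a, b]])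
    (hq' : ContinuousOn q' [[a, b]]) (hmem : MapsTo γ [[a, b]] U) :
    ∫ x in a..b, (fderiv ℝ F (γ x) (γ' x) * q x + F (γ x) * q' x) =
      F (γ b) * q b - F (γ a) * q a := by
  have hγc : ContinuousOn γ [[a, b]] := HasDerivAt.continuousOn hγ
  refine intervalIntegral.integral_eq_sub_of_hasDerivAt (f := fun x ↦ F (γ x) * q x)
    (fun x hx ↦ ?_) ?_
  · exact (((hF.contDiffAt (hU.mem_nhds (hmem hx))).differentiableAt
      one_ne_zero).hasFDerivAt.comp_hasDerivAt x (hγ x hx)).mul (hq x hx)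
  · exact (((((hF.continuousOn_fderiv_of_isOpen hU le_rfl).comp hγc hmem).clm_apply hγ').mul
      (HasDerivAt.continuousOn hq)).add
        ((hF.continuousOn.comp hγc hmem).mul hq')).intervalIntegrable

theorem hasDerivAt_integral_affine_homotopy_fderiv (hF : ContDiffOn ℝ 1 F U) (hU : IsOpen U)
    {p q p' q' : ℝ → ℂ} {a b t₀ : ℝ} {s : Set ℝ}
    (hp : ContinuousOn p [[a, b]]) (hq : ContinuousOn q [[a, b]])
    (hp' : ContinuousOn p' [[a, b]]) (hq' : ContinuousOn q' [[a, b]])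
    (hs : s ∈ 𝓝 t₀) (hmem : ∀ t ∈ s, ∀ x ∈ [[a, b]], p x + t * q x ∈ U) :
    HasDerivAt (fun t : ℝ ↦ ∫ x in a..b, F (p x + t * q x) * (p' x + t * q' x))
      (∫ x in a..b, (fderiv ℝ F (p x + t₀ * q x) (q x) * (p' x + t₀ * q' x) +
        F (p x + t₀ * q x) * q' x)) t₀ := by
  have hfamily {u v : ℝ → ℂ} (hu : ContinuousOn u [[a, b]]) (hv : ContinuousOn v [[a, b]]) :
      ContinuousOn (fun r : ℝ × ℝ ↦ u r.2 + r.1 * v r.2) (s ×ˢ [[a, b]]) :=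
    (hu.comp continuousOn_snd fun r hr ↦ hr.2).add
      (ContinuousOn.mul (by fun_prop) (hv.comp continuousOn_snd fun r hr ↦ hr.2))
  have hmaps : MapsTo (fun r : ℝ × ℝ ↦ p r.2 + r.1 * q r.2) (s ×ˢ [[a, b]]) U :=
    fun r hr ↦ hmem r.1 hr.1 r.2 hr.2
  have hFγ := hF.continuousOn.comp (hfamily hp hq) hmaps
  have hLγ := (hF.continuousOn_fderiv_of_isOpen hU le_rfl).comp (hfamily hp hq) hmaps
  have hline (u v : ℂ) (t : ℝ) : HasDerivAt (fun t : ℝ ↦ u + t * v) v t := by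
    simpa using ((hasDerivAt_id t).ofReal_comp.mul_const v).const_add u
  refine hasDerivAt_intervalIntegral_of_continuousOn
    (F := fun t x ↦ F (p x + t * q x) * (p' x + t * q' x))
    (F' := fun t x ↦ fderiv ℝ F (p x + t * q x) (q x) * (p' x + t * q' x) +
      F (p x + t * q x) * q' x) hs
    (fun t ht ↦ (hFγ.mul (hfamily hp' hq')).comp (f := fun x ↦ (t, x)) (by fun_prop)
      fun x hx ↦ ⟨ht, hx⟩)
    (((hLγ.clm_apply (hq.comp continuousOn_snd fun r hr ↦ hr.2)).mul (hfamily hp' hq')).add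
      (hFγ.mul (hq'.comp continuousOn_snd fun r hr ↦ hr.2)))
    fun t ht x hx ↦ ?_
  exact (((hF.contDiffAt (hU.mem_nhds (hmem t ht x hx))).differentiableAt
    one_ne_zero).hasFDerivAt.comp_hasDerivAt t (hline (p x) (q x) t)).mul (hline (p' x) (q' x) t)

/-- Differentiating under the integral sign gives `dF(q) γ' + F q'` for the curve `γ = p + t₀ q`;
subtracting the exact term `(F(γ) q)' = dF(γ') q + F q'` leaves a multiple of `∂F/∂z̄`. -/
theorem hasDerivAt_integral_affine_homotopy (hF : ContDiffOn ℝ 1 F U) (hU : IsOpen U)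
    {p q p' q' : ℝ → ℂ} {a b t₀ : ℝ} {s : Set ℝ}
    (hp : ∀ x ∈ [[a, b]], HasDerivAt p (p' x) x) (hq : ∀ x ∈ [[a, b]], HasDerivAt q (q' x) x)
    (hp' : ContinuousOn p' [[a, b]]) (hq' : ContinuousOn q' [[a, b]])
    (hs : s ∈ 𝓝 t₀) (hmem : ∀ t ∈ s, ∀ x ∈ [[a, b]], p x + t * q x ∈ U) :
    HasDerivAt (fun t : ℝ ↦ ∫ x in a..b, F (p x + t * q x) * (p' x + t * q' x))
      (F (p b + t₀ * q b) * q b - F (p a + t₀ * q a) * q a +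
        Complex.I * ∫ x in a..b, ((conj (q x) * (p' x + t₀ * q' x)).im : ℂ) *
          cauchyRiemann F (p x + t₀ * q x)) t₀ := by
  have hpc : ContinuousOn p [[a, b]] := HasDerivAt.continuousOn hp
  have hqc : ContinuousOn q [[a, b]] := HasDerivAt.continuousOn hq
  have hγ' : ContinuousOn (fun x ↦ p' x + t₀ * q' x) [[a, b]] := hp'.add (hq'.const_mul _)
  have hmem₀ : MapsTo (fun x ↦ p x + t₀ * q x) [[a, b]] U := hmem t₀ (mem_of_mem_nhds hs)
  have hγ : ContinuousOn (fun x ↦ p x + t₀ * q x) [[a, b]] := hpc.add (hqc.const_mul _)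
  have hFγ := hF.continuousOn.comp hγ hmem₀
  have hLγ := (hF.continuousOn_fderiv_of_isOpen hU le_rfl).comp hγ hmem₀
  have hCRγ : ContinuousOn (fun x ↦ cauchyRiemann F (p x + t₀ * q x)) [[a, b]] :=
    (contDiffOn_cauchyRiemann hF hU (m := 0) (by norm_num)).continuousOn.comp hγ hmem₀
  convert hasDerivAt_integral_affine_homotopy_fderiv hF hU hpc hqc hp' hq' hs hmem using 1
  rw [← integral_fderiv_mul_add_comp_mul (γ := fun x ↦ p x + t₀ * q x) hF hU
      (fun x hx ↦ (hp x hx).add ((hq x hx).const_mul (t₀ : ℂ))) hq hγ' hq' hmem₀,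
    ← intervalIntegral.integral_const_mul, ← intervalIntegral.integral_add]
  · refine intervalIntegral.integral_congr fun x _ ↦ ?_
    simp only [cauchyRiemann]
    linear_combination -realLinear_apply_mul_sub (fderiv ℝ F (p x + t₀ * q x)) (q x)
      (p' x + t₀ * q' x)
  · exact (((hLγ.clm_apply hγ').mul hqc).add (hFγ.mul hq')).intervalIntegrable
  · exact (continuousOn_const.mul (((continuous_ofReal.comp
      Complex.continuous_im).comp_continuousOn ((continuous_conj.comp_continuousOn hqc).mul
        hγ')).mul hCRγ)).intervalIntegrable

end CauchyRiemann

section HorizontalMean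

/-- The mean of `F` over the segment `{x + iy : |x| ≤ 1/2}`, i.e. the constant Fourier coefficient
at height `y` of a `1`-periodic function. -/
noncomputable def horizontalMean (F : ℂ → ℂ) (y : ℝ) : ℂ :=
  ∫ x in (-1 / 2 : ℝ)..1 / 2, F (x + y * Complex.I)

variable {F G : ℂ → ℂ} {y : ℝ}

theorem continuousOn_comp_horizontal (hF : ContinuousOn F upperHalfPlaneSet) (hy : 0 < y)
    (s : Set ℝ) : ContinuousOn (fun x : ℝ ↦ F (x + y * Complex.I)) s :=
  hF.comp (by fun_prop) fun x _ ↦ by simpa using hy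

theorem horizontalMean_congr (hy : 0 < y) (h : EqOn F G upperHalfPlaneSet) :
    horizontalMean F y = horizontalMean G y :=
  intervalIntegral.integral_congr fun x _ ↦ h (by simpa using hy)

theorem horizontalMean_add (hF : ContinuousOn F upperHalfPlaneSet)
    (hG : ContinuousOn G upperHalfPlaneSet) (hy : 0 < y) :
    horizontalMean (fun z ↦ F z + G z) y = horizontalMean F y + horizontalMean G y :=
  intervalIntegral.integral_add (continuousOn_comp_horizontal hF hy _).intervalIntegrable
    (continuousOn_comp_horizontal hG hy _).intervalIntegrable

theorem horizontalMean_const_mul (c : ℂ) :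
    horizontalMean (fun z ↦ c * F z) y = c * horizontalMean F y :=
  intervalIntegral.integral_const_mul c _

theorem horizontalMean_conj :
    horizontalMean (fun z ↦ conj (F z)) y = conj (horizontalMean F y) :=
  intervalIntegral.intervalIntegral_conj

theorem tendsto_horizontalMean_zero (hF : Tendsto F (comap Complex.im atTop) (𝓝 0)) :
    Tendsto (horizontalMean F) atTop (𝓝 0) := by
  refine Metric.tendsto_nhds.2 fun ε hε ↦ ?_
  have hsmall := eventually_comap.1 (Metric.tendsto_nhds.1 hF (ε / 2) (half_pos hε))
  filter_upwards [hsmall] with y hy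
  have hle : ‖horizontalMean F y‖ ≤ ε / 2 * |1 / 2 - -1 / 2| :=
    intervalIntegral.norm_integral_le_of_norm_le_const fun x _ ↦ by
      simpa using (hy (x + y * Complex.I) (by simp)).le
  rw [dist_zero_right]
  norm_num at hle
  linarith

theorem hasDerivAt_horizontalMean (hF : ContDiffOn ℝ 1 F upperHalfPlaneSet)
    (hper : ∀ z : ℂ, 0 < z.im → F (z + 1) = F z) (hy : 0 < y) :
    HasDerivAt (horizontalMean F) (-Complex.I * horizontalMean (cauchyRiemann F) y) y := by
  have hvariation := hasDerivAt_integral_affine_homotopy hF isOpen_upperHalfPlaneSet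
    (p := fun x ↦ x) (q := fun _ ↦ Complex.I) (p' := fun _ ↦ 1) (q' := fun _ ↦ 0)
    (a := -1 / 2) (b := 1 / 2) (fun x _ ↦ (hasDerivAt_id x).ofReal_comp)
    (fun x _ ↦ hasDerivAt_const x Complex.I) continuousOn_const continuousOn_const
    (Ioi_mem_nhds hy) fun t ht x _ ↦ by simpa using ht
  have hends : F ((1 / 2 : ℝ) + y * Complex.I) = F ((-1 / 2 : ℝ) + y * Complex.I) := by
    rw [← hper ((-1 / 2 : ℝ) + y * Complex.I) (by simpa using hy)]
    push_cast
    ring_nf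
  rw [hends, sub_self, zero_add] at hvariation
  convert hvariation using 1
  · ext t
    simp [horizontalMean]
  · simp [horizontalMean]

theorem hasDerivAt_re_horizontalMean (hF : ContDiffOn ℝ 1 F upperHalfPlaneSet)
    (hper : ∀ z : ℂ, 0 < z.im → F (z + 1) = F z) (hy : 0 < y) :
    HasDerivAt (fun t ↦ (horizontalMean F t).re) (horizontalMean (cauchyRiemann F) y).im y := by
  exact (reCLM.hasFDerivAt.comp_hasDerivAt y (hasDerivAt_horizontalMean hF hper hy)).congr_deriv
    (by simp)

theorem im_intervalIntegral_nonneg {f : ℝ → ℂ} {a b : ℝ} (hab : a ≤ b)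
    (hf : ∀ x ∈ Icc a b, 0 ≤ (f x).im) : 0 ≤ (∫ x in a..b, f x).im := by
  by_cases hint : IntervalIntegrable f volume a b
  · exact (intervalIntegral.integral_nonneg hab hf).trans_eq (imCLM.intervalIntegral_comp_comm hint)
  · simp [intervalIntegral.integral_undef hint]

theorem im_horizontalMean_pos (hF : ContinuousOn F upperHalfPlaneSet) (hy : 0 < y)
    (hnonneg : ∀ z : ℂ, 0 < z.im → 0 ≤ (F z).im)
    (hpos : ∃ x ∈ Icc (-1 / 2 : ℝ) (1 / 2), 0 < (F (x + y * Complex.I)).im) :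
    0 < (horizontalMean F y).im := by
  have hcont := continuousOn_comp_horizontal hF hy (Icc (-1 / 2) (1 / 2))
  rw [horizontalMean, ← imCLM_apply, ← imCLM.intervalIntegral_comp_comm
    (hcont.intervalIntegrable_of_Icc (by norm_num))]
  exact intervalIntegral.integral_pos (by norm_num) (imCLM.continuous.comp_continuousOn hcont)
    (fun x _ ↦ hnonneg _ (by simpa using hy)) hpos

end HorizontalMean

section WeightTwo

/-- Invariance of a function on the upper half-plane under the weight `k` action of the generators
`T : z ↦ z + 1` and `S : z ↦ -1 / z` of `SL(2, ℤ)`. -/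
structure IsWeightInvariant (k : ℤ) (F : ℂ → ℂ) : Prop where
  add_one : ∀ z : ℂ, 0 < z.im → F (z + 1) = F z
  neg_one_div : ∀ z : ℂ, 0 < z.im → F (-1 / z) = z ^ k * F z

theorem ne_zero_of_im_pos {z : ℂ} (hz : 0 < z.im) : z ≠ 0 := by
  rintro rfl
  simp at hz

theorem im_neg_one_div (z : ℂ) : (-1 / z).im = z.im / normSq z := by
  simp [neg_div]

theorem im_neg_one_div_pos {z : ℂ} (hz : 0 < z.im) : 0 < (-1 / z).im :=
  im_neg_one_div z ▸ div_pos hz (normSq_pos.2 (ne_zero_of_im_pos hz))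

theorem IsWeightInvariant.mul {k l : ℤ} {F G : ℂ → ℂ} (hF : IsWeightInvariant k F)
    (hG : IsWeightInvariant l G) : IsWeightInvariant (k + l) (fun z ↦ F z * G z) where
  add_one z hz := by rw [hF.add_one z hz, hG.add_one z hz]
  neg_one_div z hz := by
    rw [hF.neg_one_div z hz, hG.neg_one_div z hz, zpow_add₀ (ne_zero_of_im_pos hz)]
    ring

/-- The upper unit semicircle as a graph over the real axis; over `|x| ≤ 1/2` it is the bottom edge
of the standard fundamental domain. -/
noncomputable def unitArc (x : ℝ) : ℂ := x + √(1 - x ^ 2) * Complex.I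

@[simp] theorem unitArc_im (x : ℝ) : (unitArc x).im = √(1 - x ^ 2) := by simp [unitArc]

theorem neg_one_div_unitArc {x : ℝ} (hx : x ^ 2 ≤ 1) : -1 / unitArc x = unitArc (-x) := by
  have hnorm : unitArc x * unitArc (-x) = -1 := by
    have hsq : ((√(1 - x ^ 2) : ℝ) : ℂ) ^ 2 = 1 - x ^ 2 := by
      exact_mod_cast Real.sq_sqrt (sub_nonneg.2 hx)
    simp only [unitArc, neg_sq, ofReal_neg]
    linear_combination ((√(1 - x ^ 2) : ℝ) : ℂ) ^ 2 * I_sq - hsq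
  rw [← hnorm, mul_div_cancel_left₀ _ (left_ne_zero_of_mul (hnorm ▸ neg_ne_zero.2 one_ne_zero))]

theorem hasDerivAt_sqrt_one_sub_sq {x : ℝ} (hx : x ^ 2 < 1) :
    HasDerivAt (fun x ↦ √(1 - x ^ 2)) (-(x / √(1 - x ^ 2))) x := by
  convert ((hasDerivAt_pow 2 x).const_sub 1).sqrt (sub_pos.2 hx).ne' using 1
  norm_num
  ring

theorem hasDerivAt_unitArc {x : ℝ} (hx : x ^ 2 < 1) :
    HasDerivAt unitArc (1 - (x / √(1 - x ^ 2) : ℝ) * Complex.I) x := by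
  refine ((hasDerivAt_id x).ofReal_comp.add
    ((hasDerivAt_sqrt_one_sub_sq hx).ofReal_comp.mul_const Complex.I)).congr_deriv ?_
  push_cast
  ring

/-- The involution `S` reverses the arc, and `F(z) dz` is `S`-invariant in weight two. -/
theorem IsWeightInvariant.integral_unitArc_eq_zero {F : ℂ → ℂ} (hF : IsWeightInvariant 2 F)
    {a : ℝ} (ha : |a| < 1) :
    ∫ x in -a..a, F (unitArc x) * (1 - (x / √(1 - x ^ 2) : ℝ) * Complex.I) = 0 := by
  have hodd : ∫ x in -a..a, F (unitArc x) * (1 - (x / √(1 - x ^ 2) : ℝ) * Complex.I) =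
      -∫ x in -a..a, F (unitArc (-x)) * (1 - (-x / √(1 - (-x) ^ 2) : ℝ) * Complex.I) := by
    rw [← intervalIntegral.integral_neg]
    refine intervalIntegral.integral_congr fun x hx ↦ ?_
    have hxa : |x| ≤ |a| := by
      rcases mem_uIcc.1 hx with h | h
      · exact abs_le_abs h.2 (neg_le.1 h.1)
      · exact (abs_le_abs (h.2) (by linarith [h.1])).trans_eq (abs_neg a)
    have hx1 : x ^ 2 < 1 := (sq_lt_one_iff_abs_lt_one x).2 (hxa.trans_lt ha)
    have hs : 0 < √(1 - x ^ 2) := Real.sqrt_pos.2 (sub_pos.2 hx1)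
    have hs0 : (√(1 - x ^ 2) : ℂ) ≠ 0 := ofReal_ne_zero.2 hs.ne'
    have hsq : (√(1 - x ^ 2) : ℂ) ^ 2 = 1 - x ^ 2 := by
      exact_mod_cast Real.sq_sqrt (sub_nonneg.2 hx1.le)
    rw [← neg_one_div_unitArc hx1.le, hF.neg_one_div _ (by simpa using hs)]
    simp only [unitArc, neg_sq]
    push_cast
    field_simp
    linear_combination F (x + √(1 - x ^ 2) * Complex.I) *
      ((x + √(1 - x ^ 2) * Complex.I) * Complex.I * hsq +
        ((x + √(1 - x ^ 2) * Complex.I) * x * √(1 - x ^ 2) + √(1 - x ^ 2)) * I_sq)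
  have hflip := intervalIntegral.integral_comp_neg (a := -a) (b := a)
    fun x ↦ F (unitArc x) * (1 - (x / √(1 - x ^ 2) : ℝ) * Complex.I)
  rw [neg_neg] at hflip
  rw [hflip] at hodd
  exact self_eq_neg.1 hodd

theorem sq_le_one_quarter_of_mem {x : ℝ} (hx : x ∈ [[(-1 / 2 : ℝ), 1 / 2]]) : x ^ 2 ≤ 1 / 4 := by
  rw [uIcc_of_le (by norm_num)] at hx
  nlinarith [hx.1, hx.2]

theorem half_lt_sqrt_one_sub_sq {x : ℝ} (hx : x ∈ [[(-1 / 2 : ℝ), 1 / 2]]) :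
    1 / 2 < √(1 - x ^ 2) :=
  Real.lt_sqrt_of_sq_lt (by linarith [sq_le_one_quarter_of_mem hx])

theorem im_unitArc_add_pos {x t : ℝ} (hx : x ∈ [[(-1 / 2 : ℝ), 1 / 2]]) (ht : -1 < t) :
    0 < (unitArc x + t * ((1 - √(1 - x ^ 2) : ℝ) * Complex.I)).im := by
  have hlt := half_lt_sqrt_one_sub_sq hx
  have hle : √(1 - x ^ 2) ≤ 1 := Real.sqrt_le_one.2 (by nlinarith)
  have him : (unitArc x + t * ((1 - √(1 - x ^ 2) : ℝ) * Complex.I)).im =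
      √(1 - x ^ 2) + t * (1 - √(1 - x ^ 2)) := by simp
  nlinarith

/-- The integral of `F dz` along the curve `x ↦ unitArc x + t (x + i - unitArc x)`, `|x| ≤ 1/2`.
As `t` runs from `0` to `1` these curves deform the unit arc into the segment of height one. -/
noncomputable def deformedArcIntegral (F : ℂ → ℂ) (t : ℝ) : ℂ :=
  ∫ x in (-1 / 2 : ℝ)..1 / 2, F (unitArc x + t * ((1 - √(1 - x ^ 2) : ℝ) * Complex.I)) *
    (1 - (x / √(1 - x ^ 2) : ℝ) * Complex.I + t * ((x / √(1 - x ^ 2) : ℝ) * Complex.I))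

theorem deformedArcIntegral_one (F : ℂ → ℂ) : deformedArcIntegral F 1 = horizontalMean F 1 := by
  refine intervalIntegral.integral_congr fun x _ ↦ ?_
  have hpoint : unitArc x + (1 : ℝ) * ((1 - √(1 - x ^ 2) : ℝ) * Complex.I) =
      x + (1 : ℝ) * Complex.I := by
    simp only [unitArc]
    push_cast
    ring
  simp only [hpoint]
  push_cast
  ring

theorem IsWeightInvariant.deformedArcIntegral_zero {F : ℂ → ℂ} (hF : IsWeightInvariant 2 F) :
    deformedArcIntegral F 0 = 0 := by
  simpa [deformedArcIntegral, neg_div] using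
    hF.integral_unitArc_eq_zero (a := 1 / 2) (by norm_num [abs_of_pos])

theorem hasDerivAt_deformedArcIntegral {F : ℂ → ℂ} (hF : ContDiffOn ℝ 1 F upperHalfPlaneSet)
    (hper : ∀ z : ℂ, 0 < z.im → F (z + 1) = F z) {t : ℝ} (ht : -1 < t) :
    HasDerivAt (deformedArcIntegral F)
      (-Complex.I * ∫ x in (-1 / 2 : ℝ)..1 / 2, (1 - √(1 - x ^ 2) : ℝ) *
        cauchyRiemann F (unitArc x + t * ((1 - √(1 - x ^ 2) : ℝ) * Complex.I))) t := by
  have hlt (x : ℝ) (hx : x ∈ [[(-1 / 2 : ℝ), 1 / 2]]) : x ^ 2 < 1 := by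
    linarith [sq_le_one_quarter_of_mem hx]
  have hdiv : ContinuousOn (fun x : ℝ ↦ x / √(1 - x ^ 2)) [[(-1 / 2 : ℝ), 1 / 2]] :=
    continuousOn_id.div (by fun_prop) fun x hx ↦ (Real.sqrt_pos.2 (sub_pos.2 (hlt x hx))).ne'
  have hslope : ContinuousOn (fun x : ℝ ↦ ((x / √(1 - x ^ 2) : ℝ) : ℂ) * Complex.I)
      [[(-1 / 2 : ℝ), 1 / 2]] :=
    (continuous_ofReal.comp_continuousOn hdiv).mul continuousOn_const
  have hsq : (-1 / 2 : ℝ) ^ 2 = (1 / 2) ^ 2 := by norm_num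
  have hends : F (unitArc (1 / 2) + t * ((1 - √(1 - (1 / 2) ^ 2) : ℝ) * Complex.I)) =
      F (unitArc (-1 / 2) + t * ((1 - √(1 - (1 / 2) ^ 2) : ℝ) * Complex.I)) := by
    rw [← hper (unitArc (-1 / 2) + _) (hsq ▸ im_unitArc_add_pos left_mem_uIcc ht)]
    simp only [unitArc, hsq]
    push_cast
    ring_nf
  have hvariation := hasDerivAt_integral_affine_homotopy hF isOpen_upperHalfPlaneSet
    (p := unitArc) (q := fun x ↦ (1 - √(1 - x ^ 2) : ℝ) * Complex.I)
    (fun x hx ↦ hasDerivAt_unitArc (hlt x hx))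
    (fun x hx ↦ (((hasDerivAt_sqrt_one_sub_sq (hlt x hx)).const_sub 1).congr_deriv
      (neg_neg _)).ofReal_comp.mul_const Complex.I)
    (continuousOn_const.sub hslope) hslope (Ioi_mem_nhds ht)
    fun u hu x hx ↦ im_unitArc_add_pos hx hu
  refine hvariation.congr_deriv ?_
  rw [hsq, hends, sub_self, zero_add, neg_mul, ← mul_neg, ← intervalIntegral.integral_neg]
  refine congrArg (Complex.I * ·) (intervalIntegral.integral_congr fun x _ ↦ ?_)
  have harea : (conj ((1 - √(1 - x ^ 2) : ℝ) * Complex.I) *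
      (1 - (x / √(1 - x ^ 2) : ℝ) * Complex.I + t * ((x / √(1 - x ^ 2) : ℝ) * Complex.I))).im =
        -(1 - √(1 - x ^ 2)) := by
    simp
  simp only [harea, ofReal_neg, neg_mul]

theorem IsWeightInvariant.re_horizontalMean_one_nonneg {F : ℂ → ℂ} (hF : IsWeightInvariant 2 F)
    (hd : ContDiffOn ℝ 1 F upperHalfPlaneSet)
    (hcr : ∀ z : ℂ, 0 < z.im → 0 ≤ (cauchyRiemann F z).im) :
    0 ≤ (horizontalMean F 1).re := by
  have hderiv {t : ℝ} (ht : -1 < t) :=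
    reCLM.hasFDerivAt.comp_hasDerivAt t (hasDerivAt_deformedArcIntegral hd hF.add_one ht)
  have hmono : MonotoneOn (fun t ↦ (deformedArcIntegral F t).re) (Icc 0 1) := by
    refine monotoneOn_of_hasDerivWithinAt_nonneg (convex_Icc 0 1)
      (fun t ht ↦ (hderiv (by linarith [ht.1])).continuousAt.continuousWithinAt)
      (fun t ht ↦ (hderiv (by linarith [(interior_subset ht).1])).hasDerivWithinAt) fun t ht ↦ ?_
    rw [reCLM_apply, neg_mul, neg_re, I_mul_re, neg_neg]
    refine im_intervalIntegral_nonneg (by norm_num) fun x hx ↦ ?_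
    rw [im_ofReal_mul]
    exact mul_nonneg (sub_nonneg.2 (Real.sqrt_le_one.2 (by nlinarith)))
      (hcr _ (im_unitArc_add_pos (Icc_subset_uIcc hx) (by linarith [(interior_subset ht).1])))
  simpa [hF.deformedArcIntegral_zero, deformedArcIntegral_one] using
    hmono (left_mem_Icc.2 zero_le_one) (right_mem_Icc.2 zero_le_one) zero_le_one

/-- Stokes' theorem on the truncated fundamental domain, for a weight two form with nonnegative
area term, gives both positivity and monotonicity of the constant term. -/
theorem IsWeightInvariant.exists_pos_le_re_horizontalMean {F : ℂ → ℂ} (hF : IsWeightInvariant 2 F)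
    (hd : ContDiffOn ℝ 1 F upperHalfPlaneSet)
    (hcr : ∀ z : ℂ, 0 < z.im → 0 ≤ (cauchyRiemann F z).im)
    (hpos : ∀ y > 0, 0 < (horizontalMean (cauchyRiemann F) y).im) :
    ∃ δ > 0, ∀ y ≥ 2, δ ≤ (horizontalMean F y).re := by
  have hderiv {y : ℝ} (hy : 0 < y) := hasDerivAt_re_horizontalMean hd hF.add_one hy
  have hmono : StrictMonoOn (fun y ↦ (horizontalMean F y).re) (Ioi 0) :=
    strictMonoOn_of_hasDerivWithinAt_pos (convex_Ioi 0)
      (fun y hy ↦ (hderiv hy).continuousAt.continuousWithinAt)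
      (fun y hy ↦ (hderiv (interior_subset hy)).hasDerivWithinAt)
      fun y hy ↦ hpos y (interior_subset hy)
  refine ⟨(horizontalMean F 2).re, ?_, fun y hy ↦ hmono.monotoneOn (mem_Ioi.2 two_pos)
    (mem_Ioi.2 (two_pos.trans_le hy)) hy⟩
  exact (hF.re_horizontalMean_one_nonneg hd hcr).trans_lt
    (hmono (mem_Ioi.2 one_pos) (mem_Ioi.2 two_pos) one_lt_two)

end WeightTwo

section Xi

/-- The operator `ξ_k` on functions of a complex variable. -/
noncomputable def xiPlane (k : ℤ) (F : ℂ → ℂ) (z : ℂ) : ℂ :=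
  ((z.im ^ k : ℝ) : ℂ) * conj (cauchyRiemann F z) * Complex.I

variable {k : ℤ} {F G : ℂ → ℂ} {z : ℂ}

theorem contDiffOn_conj {n : WithTop ℕ∞} {U : Set ℂ} (hF : ContDiffOn ℝ n F U) :
    ContDiffOn ℝ n (fun w ↦ conj (F w)) U :=
  conjCLE.toContinuousLinearMap.contDiff.comp_contDiffOn hF

theorem contDiffOn_im_zpow (k : ℤ) {n : WithTop ℕ∞} :
    ContDiffOn ℝ n (fun w : ℂ ↦ ((w.im ^ k : ℝ) : ℂ)) upperHalfPlaneSet :=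
  fun _ hw ↦ (contDiffAt_im_zpow k (ne_of_gt hw)).contDiffWithinAt

theorem contDiffOn_xiPlane (k : ℤ) {n m : WithTop ℕ∞} (hF : ContDiffOn ℝ n F upperHalfPlaneSet)
    (hmn : m + 1 ≤ n) : ContDiffOn ℝ m (xiPlane k F) upperHalfPlaneSet :=
  ((contDiffOn_im_zpow k).mul (contDiffOn_conj
    (contDiffOn_cauchyRiemann hF isOpen_upperHalfPlaneSet hmn))).mul contDiffOn_const

theorem continuousOn_cauchyRiemann (hF : ContDiffOn ℝ 1 F upperHalfPlaneSet) :
    ContinuousOn (cauchyRiemann F) upperHalfPlaneSet :=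
  (contDiffOn_cauchyRiemann hF isOpen_upperHalfPlaneSet (m := 0) (by norm_num)).continuousOn

theorem differentiableAt_of_contDiffOn_one (hF : ContDiffOn ℝ 1 F upperHalfPlaneSet)
    (hz : 0 < z.im) : DifferentiableAt ℝ F z :=
  (hF.contDiffAt (isOpen_upperHalfPlaneSet.mem_nhds hz)).differentiableAt one_ne_zero

theorem IsWeightInvariant.cauchyRiemann_add_one (hF : IsWeightInvariant k F)
    (hd : ContDiffOn ℝ 1 F upperHalfPlaneSet) (hz : 0 < z.im) :
    cauchyRiemann F (z + 1) = cauchyRiemann F z := by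
  have hchain := cauchyRiemann_comp (σ := fun w ↦ w + 1)
    (differentiableAt_of_contDiffOn_one hd (by simpa using hz : 0 < (z + 1).im)) (by fun_prop)
  rw [cauchyRiemann_congr
    (eventuallyEq_of_mem (isOpen_upperHalfPlaneSet.mem_nhds hz) hF.add_one)] at hchain
  simpa using hchain.symm

theorem IsWeightInvariant.cauchyRiemann_neg_one_div (hF : IsWeightInvariant k F)
    (hd : ContDiffOn ℝ 1 F upperHalfPlaneSet) (hz : 0 < z.im) :
    cauchyRiemann F (-1 / z) = conj z ^ 2 * (z ^ k * cauchyRiemann F z) := by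
  have hz0 := ne_zero_of_im_pos hz
  have hS : HasDerivAt (fun w : ℂ ↦ -1 / w) (1 / z ^ 2) z := by
    simpa [div_eq_mul_inv] using (hasDerivAt_inv hz0).const_mul (-1)
  have hzpow : DifferentiableAt ℂ (fun w : ℂ ↦ w ^ k) z := differentiableAt_zpow.2 (Or.inl hz0)
  have hchain := cauchyRiemann_comp (σ := fun w ↦ -1 / w)
    (differentiableAt_of_contDiffOn_one hd (im_neg_one_div_pos hz)) hS.differentiableAt
  rw [cauchyRiemann_congr
      (eventuallyEq_of_mem (isOpen_upperHalfPlaneSet.mem_nhds hz) hF.neg_one_div),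
    cauchyRiemann_mul (hzpow.restrictScalars ℝ) (differentiableAt_of_contDiffOn_one hd hz),
    cauchyRiemann_eq_zero hzpow, hS.deriv, zero_mul, zero_add, map_div₀, map_one, map_pow] at hchain
  have hconj : conj z ≠ 0 := (map_ne_zero _).2 hz0
  rw [hchain]
  field_simp

theorem isWeightInvariant_xiPlane (hF : IsWeightInvariant k F)
    (hd : ContDiffOn ℝ 1 F upperHalfPlaneSet) : IsWeightInvariant (2 - k) (xiPlane k F) where
  add_one z hz := by
    simp [xiPlane, hF.cauchyRiemann_add_one hd hz]
  neg_one_div z hz := by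
    have hz0 := ne_zero_of_im_pos hz
    have hpow := zpow_ne_zero k hz0
    have hconj_pow := zpow_ne_zero k ((map_ne_zero conj).2 hz0)
    simp only [xiPlane, hF.cauchyRiemann_neg_one_div hd hz, im_neg_one_div, div_zpow]
    push_cast
    rw [← mul_conj, mul_zpow, zpow_sub₀ hz0]
    simp only [map_mul, map_pow, map_zpow₀, conj_conj]
    field_simp

theorem conjCauchyRiemann_cauchyRiemann (hF : ContDiffAt ℝ 2 F z) :
    conjCauchyRiemann (cauchyRiemann F) z =
      fderiv ℝ (fun w ↦ fderiv ℝ F w 1) z 1 +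
        fderiv ℝ (fun w ↦ fderiv ℝ F w Complex.I) z Complex.I := by
  have hd : DifferentiableAt ℝ (fderiv ℝ F) z :=
    (hF.fderiv_right (m := 1) (by norm_num)).differentiableAt one_ne_zero
  have hdir (v : ℂ) : DifferentiableAt ℝ (fun w ↦ fderiv ℝ F w v) z :=
    hd.clm_apply (differentiableAt_const v)
  have hsnd (v w : ℂ) : fderiv ℝ (fun u ↦ fderiv ℝ F u v) z w = fderiv ℝ (fderiv ℝ F) z w v := by
    simp [fderiv_clm_apply hd (differentiableAt_const v)]
  have hCR (w : ℂ) : fderiv ℝ (cauchyRiemann F) z w =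
      fderiv ℝ (fderiv ℝ F) z w 1 + Complex.I * fderiv ℝ (fderiv ℝ F) z w Complex.I := by
    rw [← hsnd, ← hsnd]
    exact congrArg (· w)
      ((hdir 1).hasFDerivAt.add ((hdir Complex.I).hasFDerivAt.const_mul Complex.I)).fderiv
  have hsymm : fderiv ℝ (fderiv ℝ F) z 1 Complex.I = fderiv ℝ (fderiv ℝ F) z Complex.I 1 :=
    hF.isSymmSndFDerivAt (by simp) 1 Complex.I
  rw [conjCauchyRiemann, hCR, hCR, hsnd, hsnd, hsymm]
  linear_combination -fderiv ℝ (fderiv ℝ F) z Complex.I Complex.I * I_sq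

theorem cauchyRiemann_xiPlane (k : ℤ) (hF : ContDiffOn ℝ 2 F upperHalfPlaneSet) (hz : 0 < z.im) :
    cauchyRiemann (xiPlane k F) z =
      (Complex.I * (k * (z.im ^ (k - 1) : ℝ)) * conj (cauchyRiemann F z) +
        (z.im ^ k : ℝ) * conj (conjCauchyRiemann (cauchyRiemann F) z)) * Complex.I := by
  have hCR : ContDiffOn ℝ 1 (cauchyRiemann F) upperHalfPlaneSet :=
    contDiffOn_cauchyRiemann hF isOpen_upperHalfPlaneSet (by norm_num)
  have him := differentiableAt_of_contDiffOn_one (contDiffOn_im_zpow k) hz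
  have hconj := differentiableAt_of_contDiffOn_one (contDiffOn_conj hCR) hz
  have hproduct := cauchyRiemann_mul_of_differentiableAt (him.mul hconj)
    (differentiableAt_const Complex.I)
  refine hproduct.trans (congrArg (· * Complex.I) ((cauchyRiemann_mul him hconj).trans ?_))
  rw [cauchyRiemann_im_zpow k hz.ne',
    cauchyRiemann_conj (differentiableAt_of_contDiffOn_one hCR hz)]

theorem xiPlane_two_sub_xiPlane (k : ℤ) (hF : ContDiffOn ℝ 2 F upperHalfPlaneSet)
    (hz : 0 < z.im) :
    xiPlane (2 - k) (xiPlane k F) z = (z.im : ℂ) ^ 2 * conjCauchyRiemann (cauchyRiemann F) z -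
      Complex.I * k * z.im * cauchyRiemann F z := by
  have him : (z.im : ℂ) ≠ 0 := ofReal_ne_zero.2 hz.ne'
  have hsq : (z.im : ℂ) ^ (2 - k) * z.im ^ k = z.im ^ 2 := by
    rw [← zpow_add₀ him, sub_add_cancel, zpow_ofNat]
  have hone : (z.im : ℂ) ^ (2 - k) * z.im ^ (k - 1) = z.im := by
    rw [← zpow_add₀ him, sub_add_sub_cancel, show (2 - 1 : ℤ) = 1 from rfl, zpow_one]
  rw [xiPlane, cauchyRiemann_xiPlane k hF hz]
  simp only [map_mul, map_add, conj_conj, conj_I, conj_ofReal, map_intCast]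
  push_cast
  linear_combination (conjCauchyRiemann (cauchyRiemann F) z) * hsq -
    Complex.I * k * cauchyRiemann F z * hone -
    (z.im : ℂ) ^ (2 - k) * (z.im ^ k * conjCauchyRiemann (cauchyRiemann F) z -
      Complex.I * k * z.im ^ (k - 1) * cauchyRiemann F z) * I_sq

theorem cauchyRiemann_of_xiPlane_two_sub_eq {w : ℂ} (hz : 0 < z.im)
    (h : xiPlane (2 - k) F z = w) :
    cauchyRiemann F z = Complex.I * (conj w * (z.im ^ (k - 2) : ℝ)) := by
  have hcancel : (z.im : ℂ) ^ (2 - k) * z.im ^ (k - 2) = 1 := by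
    rw [← zpow_add₀ (ofReal_ne_zero.2 hz.ne'), sub_add_sub_cancel, sub_self, zpow_zero]
  rw [← h, xiPlane]
  simp only [map_mul, conj_conj, conj_I, conj_ofReal]
  push_cast
  linear_combination -cauchyRiemann F z * hcancel +
    (z.im : ℂ) ^ (2 - k) * z.im ^ (k - 2) * cauchyRiemann F z * I_sq

end Xi

section Pairing

variable {k : ℤ} {F G M : ℂ → ℂ}

theorem exists_ne_zero_of_horizontal (hG : DifferentiableOn ℂ G upperHalfPlaneSet)
    (hG0 : ∃ z : ℂ, 0 < z.im ∧ G z ≠ 0) {y : ℝ} (hy : 0 < y) :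
    ∃ x ∈ Icc (-1 / 2 : ℝ) (1 / 2), G (x + y * Complex.I) ≠ 0 := by
  by_contra! hzero
  obtain ⟨w, hw, hGw⟩ := hG0
  have hline : Tendsto (fun x : ℝ ↦ (x + y * Complex.I : ℂ)) (𝓝[≠] 0) (𝓝[≠] (y * Complex.I)) := by
    refine tendsto_nhdsWithin_of_tendsto_nhds_of_eventually_within _ ?_ ?_
    · exact tendsto_nhdsWithin_of_tendsto_nhds
        (Continuous.tendsto' (by fun_prop) _ _ (by simp))
    · filter_upwards [self_mem_nhdsWithin] with x hx
      simpa using hx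
  have hfreq : ∃ᶠ z in 𝓝[≠] (y * Complex.I), G z = 0 := by
    refine hline.frequently (Eventually.frequently ?_)
    filter_upwards [nhdsWithin_le_nhds (Icc_mem_nhds (by norm_num : (-1 / 2 : ℝ) < 0)
      (by norm_num : (0 : ℝ) < 1 / 2))] with x hx using hzero x hx
  have hanalytic : AnalyticOnNhd ℂ G upperHalfPlaneSet := hG.analyticOnNhd isOpen_upperHalfPlaneSet
  exact hGw (hanalytic.eqOn_zero_of_preconnected_of_frequently_eq_zero
    (convex_halfSpace_im_gt 0).isPreconnected (by simpa using hy) hfreq hw)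

theorem contDiffOn_real_of_differentiableOn {n : WithTop ℕ∞}
    (hG : DifferentiableOn ℂ G upperHalfPlaneSet) : ContDiffOn ℝ n G upperHalfPlaneSet :=
  (hG.contDiffOn isOpen_upperHalfPlaneSet).restrict_scalars ℝ

/-- The area term `-d(F G dz)` is `|G|² y ^ (k - 2) dx ∧ dy`, the integrand of the Petersson norm
of `G`. -/
theorem IsWeightInvariant.exists_pos_le_re_horizontalMean_mul (hF : IsWeightInvariant (2 - k) F)
    (hFd : ContDiffOn ℝ 1 F upperHalfPlaneSet) (hG : IsWeightInvariant k G)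
    (hGd : DifferentiableOn ℂ G upperHalfPlaneSet) (hG0 : ∃ z : ℂ, 0 < z.im ∧ G z ≠ 0)
    (hξ : EqOn (xiPlane (2 - k) F) G upperHalfPlaneSet) :
    ∃ δ > 0, ∀ y ≥ 2, δ ≤ (horizontalMean (fun z ↦ F z * G z) y).re := by
  have hd : ContDiffOn ℝ 1 (fun z ↦ F z * G z) upperHalfPlaneSet :=
    hFd.mul (contDiffOn_real_of_differentiableOn hGd)
  have harea {z : ℂ} (hz : 0 < z.im) :
      (cauchyRiemann (fun z ↦ F z * G z) z).im = normSq (G z) * z.im ^ (k - 2) := by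
    rw [cauchyRiemann_mul_of_differentiableAt (differentiableAt_of_contDiffOn_one hFd hz)
      (hGd.differentiableAt (isOpen_upperHalfPlaneSet.mem_nhds hz)),
      cauchyRiemann_of_xiPlane_two_sub_eq hz (hξ hz),
      show ∀ c w : ℂ, Complex.I * (conj w * c) * w = Complex.I * (w * conj w * c) by intros; ring,
      mul_conj, ← ofReal_mul, I_mul_im, ofReal_re]
  have hnonneg (z : ℂ) (hz : 0 < z.im) : 0 ≤ (cauchyRiemann (fun z ↦ F z * G z) z).im :=
    harea hz ▸ mul_nonneg (normSq_nonneg _) (zpow_pos hz _).le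
  have hweight := hF.mul hG
  rw [sub_add_cancel] at hweight
  refine hweight.exists_pos_le_re_horizontalMean hd hnonneg fun y hy ↦ ?_
  obtain ⟨x, hx, hGx⟩ := exists_ne_zero_of_horizontal hGd hG0 hy
  have him : 0 < (x + y * Complex.I : ℂ).im := by simpa using hy
  exact im_horizontalMean_pos (continuousOn_cauchyRiemann hd) hy hnonneg
    ⟨x, hx, harea him ▸ mul_pos (normSq_pos.2 hGx) (zpow_pos him _)⟩

theorem IsWeightInvariant.not_tendsto_mul_zero (hF : IsWeightInvariant (2 - k) F)
    (hFd : ContDiffOn ℝ 1 F upperHalfPlaneSet) (hG : IsWeightInvariant k G)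
    (hGd : DifferentiableOn ℂ G upperHalfPlaneSet) (hG0 : ∃ z : ℂ, 0 < z.im ∧ G z ≠ 0)
    (hξ : EqOn (xiPlane (2 - k) F) G upperHalfPlaneSet) :
    ¬ Tendsto (fun z ↦ F z * G z) (comap Complex.im atTop) (𝓝 0) := by
  intro hlim
  obtain ⟨δ, hδ, hle⟩ := hF.exists_pos_le_re_horizontalMean_mul hFd hG hGd hG0 hξ
  have hre : Tendsto (fun y ↦ (horizontalMean (fun z ↦ F z * G z) y).re) atTop (𝓝 0) :=
    (continuous_re.tendsto' _ _ zero_re).comp (tendsto_horizontalMean_zero hlim)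
  exact hδ.not_ge (ge_of_tendsto hre ((eventually_ge_atTop 2).mono hle))

/-- The function `y ^ k * conj G`, against which `∂M/∂z̄` is integrated in the pairing of `ξ_k M`
with `G`. -/
noncomputable def weightedConj (k : ℤ) (G : ℂ → ℂ) (z : ℂ) : ℂ :=
  conj (G z) * ((z.im ^ k : ℝ) : ℂ)

theorem contDiffOn_weightedConj (k : ℤ) {n : WithTop ℕ∞}
    (hG : DifferentiableOn ℂ G upperHalfPlaneSet) :
    ContDiffOn ℝ n (weightedConj k G) upperHalfPlaneSet :=
  (contDiffOn_conj (contDiffOn_real_of_differentiableOn hG)).mul (contDiffOn_im_zpow k)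

theorem cauchyRiemann_weightedConj (k : ℤ) {z : ℂ} (hG : DifferentiableAt ℂ G z) (hz : 0 < z.im) :
    cauchyRiemann (weightedConj k G) z =
      2 * weightedConj k (deriv G) z + Complex.I * k * weightedConj (k - 1) G z := by
  have hGr := hG.restrictScalars ℝ
  have hproduct := cauchyRiemann_mul (conjCLE.differentiableAt.comp z hGr)
    (hasFDerivAt_im_zpow k hz.ne').differentiableAt
  refine hproduct.trans ?_
  rw [cauchyRiemann_im_zpow k hz.ne',
    show cauchyRiemann (conjCLE ∘ G) z = _ from cauchyRiemann_conj hGr,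
    conjCauchyRiemann_eq_two_mul_deriv hG]
  simp only [weightedConj, map_mul, Function.comp_apply, conjCLE_apply, map_ofNat]
  ring

theorem re_horizontalMean_xiPlane_mul (k : ℤ) (M G : ℂ → ℂ) (y : ℝ) :
    (horizontalMean (fun z ↦ xiPlane k M z * G z) y).re =
      (horizontalMean (fun z ↦ cauchyRiemann M z * weightedConj k G z) y).im := by
  have hpointwise : (fun z ↦ xiPlane k M z * G z) =
      fun z ↦ Complex.I * conj (cauchyRiemann M z * weightedConj k G z) := by
    ext z
    simp only [xiPlane, weightedConj, map_mul, conj_conj, conj_ofReal]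
    ring
  rw [hpointwise, horizontalMean_const_mul, horizontalMean_conj, I_mul_re, conj_im, neg_neg]

theorem im_horizontalMean_cauchyRiemann_mul_weightedConj (k : ℤ)
    (hM : ContDiffOn ℝ 1 M upperHalfPlaneSet) (hG : DifferentiableOn ℂ G upperHalfPlaneSet)
    {y : ℝ} (hy : 0 < y) :
    (horizontalMean (cauchyRiemann fun z ↦ M z * weightedConj k G z) y).im =
      (horizontalMean (fun z ↦ xiPlane k M z * G z) y).re +
        (horizontalMean (fun z ↦ M z * cauchyRiemann (weightedConj k G) z) y).im := by
  have hE : ContDiffOn ℝ 1 (weightedConj k G) upperHalfPlaneSet := contDiffOn_weightedConj k hG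
  have hsum := horizontalMean_add (F := fun z ↦ cauchyRiemann M z * weightedConj k G z)
    (G := fun z ↦ M z * cauchyRiemann (weightedConj k G) z)
    ((continuousOn_cauchyRiemann hM).mul hE.continuousOn)
    (hM.continuousOn.mul (continuousOn_cauchyRiemann hE)) hy
  rw [re_horizontalMean_xiPlane_mul, ← add_im, ← hsum]
  exact congrArg Complex.im (horizontalMean_congr hy fun z hz ↦ cauchyRiemann_mul
    (differentiableAt_of_contDiffOn_one hM hz) (differentiableAt_of_contDiffOn_one hE hz))

/-- The constant term of `M y^k conj G` has derivative `Re ∫ ξ_k M · G + Im ∫ M ∂(y^k conj G)`, so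
no bound on the derivatives of `M` is needed. -/
theorem not_tendsto_mul_weightedConj_zero (hM : ContDiffOn ℝ 1 M upperHalfPlaneSet)
    (hMT : ∀ z : ℂ, 0 < z.im → M (z + 1) = M z) (hG : DifferentiableOn ℂ G upperHalfPlaneSet)
    (hGT : ∀ z : ℂ, 0 < z.im → G (z + 1) = G z) {δ : ℝ} (hδ : 0 < δ)
    (hle : ∀ᶠ y in atTop, δ ≤ (horizontalMean (fun z ↦ xiPlane k M z * G z) y).re)
    (hrem : Tendsto (fun z ↦ M z * cauchyRiemann (weightedConj k G) z)
      (comap Complex.im atTop) (𝓝 0)) :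
    ¬ Tendsto (fun z ↦ M z * weightedConj k G z) (comap Complex.im atTop) (𝓝 0) := by
  intro hlim
  have hE : ContDiffOn ℝ 1 (weightedConj k G) upperHalfPlaneSet := contDiffOn_weightedConj k hG
  have hT (z : ℂ) (hz : 0 < z.im) :
      M (z + 1) * weightedConj k G (z + 1) = M z * weightedConj k G z := by
    simp [weightedConj, hMT z hz, hGT z hz]
  have hrem_im := (Complex.continuous_im.tendsto' _ _ zero_im).comp
    (tendsto_horizontalMean_zero hrem)
  have hlarge := tendsto_atTop_of_eventually_le_deriv (half_pos hδ)
    ((eventually_gt_atTop 0).mono fun y hy ↦ hasDerivAt_re_horizontalMean (hM.mul hE) hT hy) <| by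
      filter_upwards [hle, hrem_im.eventually_const_le (neg_lt_zero.2 (half_pos hδ)),
        eventually_gt_atTop 0] with y hy hsmall hpos
      rw [Function.comp_apply] at hsmall
      rw [im_horizontalMean_cauchyRiemann_mul_weightedConj k hM hG hpos]
      linarith
  exact not_tendsto_nhds_of_tendsto_atTop hlarge 0
    ((continuous_re.tendsto' _ _ zero_re).comp (tendsto_horizontalMean_zero hlim))

end Pairing

section Growth

variable {M G : ℂ → ℂ} {a b : ℝ}

theorem tendsto_exp_mul_mul_zpow_zero {c : ℝ} (hc : c < 0) (n : ℤ) :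
    Tendsto (fun y : ℝ ↦ Real.exp (c * y) * y ^ n) atTop (𝓝 0) := by
  have hdecay := tendsto_rpow_mul_exp_neg_mul_atTop_nhds_zero n (-c) (neg_pos.2 hc)
  simpa only [Real.rpow_intCast, neg_neg, mul_comm] using hdecay

theorem tendsto_mul_mul_im_zpow_zero (hab : a < b)
    (hM : M =O[comap Complex.im atTop] fun z ↦ Real.exp (a * z.im))
    (hG : G =O[comap Complex.im atTop] fun z ↦ Real.exp (-b * z.im)) (n : ℤ) :
    Tendsto (fun z ↦ M z * (G z * (z.im ^ n : ℝ))) (comap Complex.im atTop) (𝓝 0) := by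
  have hzpow : (fun z : ℂ ↦ ((z.im ^ n : ℝ) : ℂ)) =O[comap Complex.im atTop] fun z ↦ z.im ^ n :=
    isBigO_of_le _ fun z ↦ by simp
  refine (hM.mul (hG.mul hzpow)).trans_tendsto ?_
  have hdecay := (tendsto_exp_mul_mul_zpow_zero (sub_neg.2 hab) n).comp
    (tendsto_comap (f := Complex.im))
  refine hdecay.congr fun z ↦ ?_
  rw [Function.comp_apply, ← mul_assoc, ← Real.exp_add]
  ring_nf

theorem tendsto_mul_weightedConj_zero (hab : a < b)
    (hM : M =O[comap Complex.im atTop] fun z ↦ Real.exp (a * z.im))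
    (hG : G =O[comap Complex.im atTop] fun z ↦ Real.exp (-b * z.im)) (n : ℤ) :
    Tendsto (fun z ↦ M z * weightedConj n G z) (comap Complex.im atTop) (𝓝 0) :=
  tendsto_mul_mul_im_zpow_zero hab hM ((isBigO_of_le _ fun z ↦ by simp).trans hG) n

theorem isBigO_exp_deriv (hG : DifferentiableOn ℂ G upperHalfPlaneSet)
    (hGO : G =O[comap Complex.im atTop] fun z ↦ Real.exp (b * z.im)) :
    deriv G =O[comap Complex.im atTop] fun z ↦ Real.exp (b * z.im) := by
  obtain ⟨C, hC0, hC⟩ := hGO.exists_nonneg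
  obtain ⟨N, hN⟩ := eventually_atTop.1 (eventually_comap.1 hC.bound)
  refine IsBigO.of_bound (C * Real.exp |b|) ?_
  filter_upwards [preimage_mem_comap (Ioi_mem_atTop (max N 0 + 1))] with z hz
  have him_sub {w : ℂ} (hw : w ∈ Metric.closedBall z 1) : |w.im - z.im| ≤ 1 :=
    (abs_im_le_norm (w - z)).trans (mem_closedBall_iff_norm.1 hw)
  have him {w : ℂ} (hw : w ∈ Metric.closedBall z 1) : max N 0 < w.im := by
    linarith [(abs_le.1 (him_sub hw)).1, mem_Ioi.1 (mem_preimage.1 hz)]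
  have hd : DiffContOnCl ℂ G (Metric.ball z 1) := by
    refine DifferentiableOn.diffContOnCl (hG.mono fun w hw ↦ ?_)
    rw [closure_ball z one_ne_zero] at hw
    exact (le_max_right N 0).trans_lt (him hw)
  refine (Complex.norm_deriv_le_of_forall_mem_sphere_norm_le one_pos hd
    (C := C * Real.exp |b| * ‖Real.exp (b * z.im)‖) fun w hw ↦ ?_).trans_eq (div_one _)
  have hw' := Metric.sphere_subset_closedBall hw
  have hexp : b * w.im ≤ |b| + b * z.im := by
    have := le_abs_self (b * (w.im - z.im))
    rw [abs_mul] at this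
    nlinarith [mul_le_mul_of_nonneg_left (him_sub hw') (abs_nonneg b)]
  refine (hN w.im ((le_max_left N 0).trans (him hw').le) w rfl).trans ?_
  rw [Real.norm_of_nonneg (Real.exp_nonneg _), Real.norm_of_nonneg (Real.exp_nonneg _), mul_assoc,
    ← Real.exp_add]
  gcongr

theorem tendsto_mul_cauchyRiemann_weightedConj_zero (hab : a < b)
    (hGd : DifferentiableOn ℂ G upperHalfPlaneSet)
    (hM : M =O[comap Complex.im atTop] fun z ↦ Real.exp (a * z.im))
    (hG : G =O[comap Complex.im atTop] fun z ↦ Real.exp (-b * z.im)) (k : ℤ) :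
    Tendsto (fun z ↦ M z * cauchyRiemann (weightedConj k G) z) (comap Complex.im atTop) (𝓝 0) := by
  have hlim := ((tendsto_mul_weightedConj_zero hab hM (isBigO_exp_deriv hGd hG) k).const_mul
    2).add ((tendsto_mul_weightedConj_zero hab hM hG (k - 1)).const_mul (Complex.I * k))
  rw [mul_zero, mul_zero, add_zero] at hlim
  refine hlim.congr' ?_
  filter_upwards [preimage_mem_comap (Ioi_mem_atTop (0 : ℝ))] with z hz
  rw [cauchyRiemann_weightedConj k
    (hGd.differentiableAt (isOpen_upperHalfPlaneSet.mem_nhds hz)) hz]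
  ring

end Growth

section ModularForms

variable {k : ℤ} {f : ℍ → ℂ}

theorem isWeightInvariant_comp_ofComplex (hf : ∀ γ : SL(2, ℤ), f ∣[k] γ = f) :
    IsWeightInvariant k (f ∘ ofComplex) where
  add_one z hz := by
    have hz1 : 0 < (z + 1).im := by simpa using hz
    have hslash := congrFun (hf ModularGroup.T) ⟨z, hz⟩
    have hdenom : denom (Matrix.SpecialLinearGroup.toGL ((Matrix.SpecialLinearGroup.map
        (Int.castRingHom ℝ)) ModularGroup.T)) z = 1 := by
      simp [denom, ModularGroup.coe_T]
    have hvadd : (1 : ℝ) +ᵥ (⟨z, hz⟩ : ℍ) = ⟨z + 1, hz1⟩ := by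
      ext
      simp [add_comm]
    rw [ModularForm.SL_slash_apply, modular_T_smul, hvadd, hdenom, one_zpow, mul_one] at hslash
    rwa [Function.comp_apply, Function.comp_apply, ofComplex_apply_of_im_pos hz,
      ofComplex_apply_of_im_pos hz1]
  neg_one_div z hz := by
    have hslash := congrFun (hf ModularGroup.S) ⟨z, hz⟩
    rw [SlashInvariantForm.slash_S_apply] at hslash
    rw [Function.comp_apply, Function.comp_apply, ofComplex_apply_of_im_pos hz,
      ofComplex_apply_of_im_pos (im_neg_one_div_pos hz), ← hslash, mul_left_comm,
      ← zpow_add₀ (ne_zero_of_im_pos hz), add_neg_cancel, zpow_zero, mul_one]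
    congr 1
    ext
    simp [neg_div, inv_neg]

theorem isBigO_comp_ofComplex {u : ℝ → ℝ} (hf : f =O[atImInfty] fun z ↦ u z.im) :
    (f ∘ ofComplex) =O[comap Complex.im atTop] fun z ↦ u z.im := by
  refine (hf.comp_tendsto tendsto_comap_im_ofComplex).congr' EventuallyEq.rfl ?_
  filter_upwards [preimage_mem_comap (Ioi_mem_atTop (0 : ℝ))] with z hz
  simp only [Function.comp_apply, ofComplex_apply_of_im_pos hz, UpperHalfPlane.im]

theorem HasModerateGrowth.isBigO_exp (hf : HasModerateGrowth f) {a : ℝ} (ha : 0 < a) :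
    f =O[atImInfty] fun z ↦ Real.exp (a * z.im) := by
  obtain ⟨α, hα⟩ := hf
  exact hα.trans ((isLittleO_rpow_exp_pos_mul_atTop α ha).isBigO.comp_tendsto tendsto_comap)

theorem xi_eq_xiPlane (k : ℤ) (f : ℍ → ℂ) (z : ℍ) : xi k f z = xiPlane k (f ∘ ofComplex) z := by
  simp only [xi, dbar, partialX, partialY, xiPlane, cauchyRiemann, map_mul, map_div₀, map_one,
    map_ofNat, coe_im]
  push_cast
  ring

theorem fderiv_comp_ofComplex_fderiv (F : ℂ → ℂ) (v w : ℂ) (z : ℍ) :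
    fderiv ℝ ((fun u : ℍ ↦ fderiv ℝ F (u : ℂ) v) ∘ ofComplex) z w =
      fderiv ℝ (fun u ↦ fderiv ℝ F u v) z w := by
  refine congrArg (fun L : ℂ →L[ℝ] ℂ ↦ L w) (EventuallyEq.fderiv_eq ?_)
  filter_upwards [isOpen_upperHalfPlaneSet.mem_nhds z.im_pos] with u hu
  rw [Function.comp_apply, ofComplex_apply_of_im_pos hu]

theorem IsSmooth.contDiffOn_two (hf : IsSmooth f) :
    ContDiffOn ℝ 2 (f ∘ ofComplex) upperHalfPlaneSet :=
  hf.of_le (WithTop.coe_le_coe.2 (le_top : (2 : ℕ∞) ≤ ⊤))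

theorem hypLaplacian_eq_xiPlane_xiPlane (k : ℤ) (hf : IsSmooth f) (z : ℍ) :
    hypLaplacian k f z = xiPlane (2 - k) (xiPlane k (f ∘ ofComplex)) z := by
  have hf2 := hf.contDiffOn_two
  rw [xiPlane_two_sub_xiPlane k hf2 z.im_pos, conjCauchyRiemann_cauchyRiemann
      (hf2.contDiffAt (isOpen_upperHalfPlaneSet.mem_nhds z.im_pos)),
    ← fderiv_comp_ofComplex_fderiv, ← fderiv_comp_ofComplex_fderiv]
  rfl

theorem exists_comp_ofComplex_ne_zero (hf : f ≠ 0) :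
    ∃ z : ℂ, 0 < z.im ∧ (f ∘ ofComplex) z ≠ 0 := by
  obtain ⟨z, hz⟩ := Function.ne_iff.1 hf
  exact ⟨z, z.im_pos, by simpa using hz⟩

theorem eqOn_comp_ofComplex {F : ℂ → ℂ} (h : ∀ z : ℍ, F z = f z) :
    EqOn F (f ∘ ofComplex) upperHalfPlaneSet := fun z hz ↦ by
  rw [Function.comp_apply, ofComplex_apply_of_im_pos hz, ← h]

end ModularForms

section CuspForms

variable {k : ℤ} (g : CuspForm 𝒮ℒ k)

theorem isWeightInvariant_cuspForm : IsWeightInvariant k (g ∘ ofComplex) :=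
  isWeightInvariant_comp_ofComplex fun γ ↦ SlashInvariantForm.slash_action_eqn g _ ⟨γ, rfl⟩

theorem isBigO_exp_cuspForm :
    (g ∘ ofComplex) =O[comap Complex.im atTop] fun z ↦ Real.exp (-(2 * Real.pi) * z.im) :=
  isBigO_comp_ofComplex (u := fun y ↦ Real.exp (-(2 * Real.pi) * y)) <| by
    simpa using CuspFormClass.exp_decay_atImInfty (h := 1) g one_pos one_mem_strictPeriods_SL

variable {g} {a : ℝ}

theorem not_isBigO_exp_of_xi_eq (hg : g ≠ 0) (ha : a < 2 * Real.pi) {f : ℍ → ℂ}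
    (hf : IsSmoothModularForm (2 - k) f) (hξ : xi (2 - k) f = g) :
    ¬ f =O[atImInfty] fun z ↦ Real.exp (a * z.im) := by
  intro hfO
  have hlim := tendsto_mul_mul_im_zpow_zero ha
    (isBigO_comp_ofComplex (u := fun y ↦ Real.exp (a * y)) hfO) (isBigO_exp_cuspForm g) 0
  refine (isWeightInvariant_comp_ofComplex hf.slash_eq).not_tendsto_mul_zero
    (hf.smooth.contDiffOn_two.of_le one_le_two) (isWeightInvariant_cuspForm g)
    (mdifferentiable_iff.1 g.holo')
    (exists_comp_ofComplex_ne_zero fun h ↦ hg (DFunLike.coe_injective h))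
    (eqOn_comp_ofComplex fun z ↦ ?_) (by simpa using hlim)
  rw [← xi_eq_xiPlane, hξ]

theorem not_isBigO_exp_of_hypLaplacian_eq (hg : g ≠ 0) (ha : a < 2 * Real.pi) {M : ℍ → ℂ}
    (hM : IsSmoothModularForm k M) (hΔ : hypLaplacian k M = g) :
    ¬ M =O[atImInfty] fun z ↦ Real.exp (a * z.im) := by
  intro hMO
  have hMO := isBigO_comp_ofComplex (u := fun y ↦ Real.exp (a * y)) hMO
  have hM2 := hM.smooth.contDiffOn_two
  have hM1 : ContDiffOn ℝ 1 (M ∘ ofComplex) upperHalfPlaneSet := hM2.of_le one_le_two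
  have hMk := isWeightInvariant_comp_ofComplex hM.slash_eq
  have hG := isWeightInvariant_cuspForm g
  have hGd : DifferentiableOn ℂ (g ∘ ofComplex) upperHalfPlaneSet := mdifferentiable_iff.1 g.holo'
  obtain ⟨δ, hδ, hle⟩ := (isWeightInvariant_xiPlane hMk hM1).exists_pos_le_re_horizontalMean_mul
    (contDiffOn_xiPlane k hM2 one_add_one_eq_two.le) hG hGd
    (exists_comp_ofComplex_ne_zero fun h ↦ hg (DFunLike.coe_injective h))
    (eqOn_comp_ofComplex fun z ↦ by rw [← hypLaplacian_eq_xiPlane_xiPlane k hM.smooth, hΔ])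
  exact not_tendsto_mul_weightedConj_zero hM1 hMk.add_one hGd hG.add_one hδ
    ((eventually_ge_atTop 2).mono hle)
    (tendsto_mul_cauchyRiemann_weightedConj_zero ha hGd hMO (isBigO_exp_cuspForm g) k)
    (tendsto_mul_weightedConj_zero ha hMO (isBigO_exp_cuspForm g) k)

end CuspForms

end PolyMaass

theorem mainTheorem7_general (k : ℤ) (g : CuspForm 𝒮ℒ k) (hg : g ≠ 0) {a : ℝ}
    (ha : a < 2 * Real.pi) :
    (∀ M : ℍ → ℂ, PolyMaass.IsSmoothModularForm k M → PolyMaass.hypLaplacian k M = ⇑g →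
      ¬ M =O[atImInfty] fun z ↦ Real.exp (a * z.im)) ∧
    (∀ f : ℍ → ℂ, PolyMaass.IsSmoothModularForm (2 - k) f → PolyMaass.xi (2 - k) f = ⇑g →
      ¬ f =O[atImInfty] fun z ↦ Real.exp (a * z.im)) :=
  ⟨fun _ hM hΔ ↦ PolyMaass.not_isBigO_exp_of_hypLaplacian_eq hg ha hM hΔ,
    fun _ hf hξ ↦ PolyMaass.not_isBigO_exp_of_xi_eq hg ha hf hξ⟩

theorem mainTheorem7 (k : ℤ) (g : CuspForm 𝒮ℒ k) (hg : g ≠ 0) :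
    (∀ M : ℍ → ℂ, PolyMaass.IsSmoothModularForm k M →
      PolyMaass.hypLaplacian k M = ⇑g → ¬ PolyMaass.HasModerateGrowth M) ∧
    (¬ ∃ f ∈ PolyMaass.polyharmonicMaassForms (2 - k) 1, PolyMaass.xi (2 - k) f = ⇑g) := by
  obtain ⟨hΔ, hξ⟩ := mainTheorem7_general k g hg (a := 1) (by linarith [Real.pi_gt_three])
  exact ⟨fun M hM hMg hgrowth ↦ hΔ M hM hMg (hgrowth.isBigO_exp one_pos),
    fun ⟨f, ⟨hf, _, hgrowth⟩, hfg⟩ ↦ hξ f hf hfg (hgrowth.isBigO_exp one_pos)⟩
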